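/- Let $n\ge 1$ and let $S=\{v_1,\dots,v_n\}\subset\mathbb Z^n$ be an orthogonal subset, that is, $\langle v_i,v_i\rangle\ge 1$ for all $i$ and $\langle v_i,v_j\rangle=0$ for all $i\ne j$, where $\langle\cdot,\cdot\rangle$ is the standard dot product. Let $p_4(S)$ be the number of indices $j\in\{1,\dots,n\}$ for which exactly four of the vectors $v_1,\dots,v_n$ have a nonzero $j$-th coordinate, and suppose that $p_4(S)=n$; in other words, every row of the $n\times n$ matrix with columns $v_1,\dots,v_n$ has exactly four nonzero entries. Then the sublattice $\Lambda=\mathbb Zv_1+\dots+\mathbb Zv_n$ of $\mathbb Z^n$ is not cubiquitous: there is an $x\in\mathbb Z^n$ with $\Lambda\cap(x+\{0,1\}^n)=\emptyset$. -/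

import Mathlib

/-- The notions below concern a subset `S = {v₁, …, vₙ} ⊂ ℤⁿ`, given as a family `v : Fin n → (Fin n → ℤ)`
(`v i` is the `i`-th vector and `v i j = ⟨v i, e j⟩` its `j`-th coordinate).
A subset is non-acute if `⟨vᵢ, vᵢ⟩ ≥ 1`, `⟨vᵢ, vⱼ⟩ ≤ 0` for `i ≠ j`, and
`⟨vᵢ, vᵢ⟩ ≥ -∑_{j ≠ i} ⟨vⱼ, vᵢ⟩`. -/
def IsNonAcute {n : ℕ} (v : Fin n → (Fin n → ℤ)) : Prop :=
  (∀ i, 1 ≤ v i ⬝ᵥ v i) ∧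
  (∀ i j, i ≠ j → v i ⬝ᵥ v j ≤ 0) ∧
  (∀ i, -(∑ j ∈ Finset.univ.erase i, v j ⬝ᵥ v i) ≤ v i ⬝ᵥ v i)

/-- An orthogonal subset: a non-acute one whose distinct members are orthogonal. In particular its
members are nonzero, hence pairwise distinct and linearly independent. -/
def IsOrthogonalSubset {n : ℕ} (v : Fin n → (Fin n → ℤ)) : Prop :=
  IsNonAcute v ∧ ∀ i j, i ≠ j → v i ⬝ᵥ v j = 0

/-- `E_j = {i : ⟨vᵢ, e_j⟩ ≠ 0}`: the positions of the nonzero entries in the `j`-th row of the matrix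
with columns `v₁, …, vₙ`. -/
def rowSupport {n : ℕ} (v : Fin n → (Fin n → ℤ)) (j : Fin n) : Finset (Fin n) :=
  Finset.univ.filter fun i => v i j ≠ 0

/-- `p_k(S) = |{j : |E_j| = k}|`: the number of rows with exactly `k` nonzero entries. -/
def pCount {n : ℕ} (v : Fin n → (Fin n → ℤ)) (k : ℕ) : ℕ :=
  (Finset.univ.filter fun j => (rowSupport v j).card = k).card

/-- The sublattice of `ℤⁿ` generated by `S`. -/
def latticeSpan {n : ℕ} (v : Fin n → (Fin n → ℤ)) : Submodule ℤ (Fin n → ℤ) :=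
  Submodule.span ℤ (Set.range v)

/-- The unit cube `x + {0,1}ⁿ` in `ℤⁿ`. -/
def unitCube {n : ℕ} (x : Fin n → ℤ) : Set (Fin n → ℤ) :=
  {y | ∃ d : Fin n → ℤ, (∀ i, d i = 0 ∨ d i = 1) ∧ y = x + d}

/-- A sublattice of `ℤⁿ` is cubiquitous if it meets every unit cube. -/
def IsCubiquitous {n : ℕ} (L : Submodule ℤ (Fin n → ℤ)) : Prop :=
  ∀ x : Fin n → ℤ, ((L : Set (Fin n → ℤ)) ∩ unitCube x).Nonempty

/-! Put N_i = ⟨v_i, v_i⟩. If Λ met every cube, each x in a box {0,…,M-1}^n would give a sign vector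
e with ⟨e, e⟩ = n and ⟨e, v_i⟩ ≡ ⟨1, v_i⟩ + 2⟨x, v_i⟩ mod 2N_i. Along a coordinate where v_i has
entry b ≠ 0, these residues form a progression of difference 2b, so the mean of ⟨e, v_i⟩² is at
least (N_i² - b²)/3 (`pow_mul_sub_sq_le_sum_sq`). A coordinate with b² < N_i exists, so dividing by
N_i leaves more than (N_i - 1)/3. Summing over i, Bessel's inequality gives n > ∑ (N_i - 1)/3, while
four nonzero entries per row give ∑ N_i ≥ 4n: a contradiction. -/

/-! ### Mean squares along arithmetic progressions -/

/-- The residue of `t` modulo `2 * N` lying in `[-N, N)`. -/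
def centeredMod (N t : ℤ) : ℤ := (t + N) % (2 * N) - N

/-- The `2 * N`-periodic function which equals `t ^ 3 - N ^ 2 * t` on `[-N, N]`. -/
def periodicCubic (N t : ℤ) : ℤ := centeredMod N t ^ 3 - N ^ 2 * centeredMod N t

theorem neg_le_centeredMod {N : ℤ} (hN : 0 < N) (t : ℤ) : -N ≤ centeredMod N t := by
  have := Int.emod_nonneg (t + N) (b := 2 * N) (by omega)
  unfold centeredMod
  omega

theorem centeredMod_lt {N : ℤ} (hN : 0 < N) (t : ℤ) : centeredMod N t < N := by
  have := Int.emod_lt_of_pos (t + N) (b := 2 * N) (by omega)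
  unfold centeredMod
  omega

theorem exists_eq_add_centeredMod (N t : ℤ) : ∃ q, t = 2 * N * q + centeredMod N t := by
  refine ⟨(t + N) / (2 * N), ?_⟩
  have := Int.mul_ediv_add_emod (t + N) (2 * N)
  unfold centeredMod
  linarith

theorem centeredMod_congr {N t t' : ℤ} (h : 2 * N ∣ t - t') :
    centeredMod N t = centeredMod N t' := by
  unfold centeredMod
  congr 1
  apply Int.emod_emod_of_dvd _ dvd_rfl |>.symm.trans
  apply Int.ModEq.trans (Int.mod_modEq _ _)
  exact (Int.modEq_iff_dvd.2 (by simpa using h)).symm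

theorem periodicCubic_congr {N t t' : ℤ} (h : 2 * N ∣ t - t') :
    periodicCubic N t = periodicCubic N t' := by
  unfold periodicCubic
  rw [centeredMod_congr h]

/-- With t = 2Nq + u, the cubic at t minus the cubic at u is 2N times q(3(Nq + u)² + N²(q² - 1)),
which is zero or has the sign of q. -/
theorem periodicCubic_le {N t : ℤ} (hN : 0 < N) (ht : -N ≤ t) :
    periodicCubic N t ≤ t ^ 3 - N ^ 2 * t := by
  obtain ⟨q, hq⟩ := exists_eq_add_centeredMod N t
  have hlt := centeredMod_lt hN t
  unfold periodicCubic
  set u := centeredMod N t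
  have hq0 : 0 ≤ q := by
    by_contra! h
    have : N * q ≤ N * (-1) := mul_le_mul_of_nonneg_left (by omega) hN.le
    linarith
  have key : t ^ 3 - N ^ 2 * t - (u ^ 3 - N ^ 2 * u)
      = 2 * N * (q * (3 * (N * q + u) ^ 2 + N ^ 2 * (q ^ 2 - 1))) := by
    rw [hq]; ring
  rcases hq0.eq_or_lt with h | h
  · rw [← h] at key
    linarith
  · have : 0 ≤ q ^ 2 - 1 := by nlinarith
    have : 0 ≤ 2 * N * (q * (3 * (N * q + u) ^ 2 + N ^ 2 * (q ^ 2 - 1))) := by positivity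
    linarith

theorem le_periodicCubic {N t : ℤ} (hN : 0 < N) (ht : t ≤ N) :
    t ^ 3 - N ^ 2 * t ≤ periodicCubic N t := by
  obtain ⟨q, hq⟩ := exists_eq_add_centeredMod N t
  have hle := neg_le_centeredMod hN t
  unfold periodicCubic
  set u := centeredMod N t
  have hq1 : q ≤ 1 := by
    by_contra! h
    have : N * 2 ≤ N * q := mul_le_mul_of_nonneg_left (by omega) hN.le
    linarith
  have key : t ^ 3 - N ^ 2 * t - (u ^ 3 - N ^ 2 * u)
      = 2 * N * (q * (3 * (N * q + u) ^ 2 + N ^ 2 * (q ^ 2 - 1))) := by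
    rw [hq]; ring
  -- q = 1 forces t = N and u = -N, both zeros of the cubic.
  rcases hq1.eq_or_lt with h | h
  · subst h
    have : u = -N := by linarith
    rw [this] at key ⊢
    nlinarith
  rcases (Int.lt_add_one_iff.1 (show q < 0 + 1 by simpa using h)).eq_or_lt with h | h
  · rw [h] at key
    linarith
  · have h1 : 0 ≤ q ^ 2 - 1 := by nlinarith
    have h2 : 0 ≤ 2 * N * ((-q) * (3 * (N * q + u) ^ 2 + N ^ 2 * (q ^ 2 - 1))) := by
      have : 0 ≤ -q := by omega
      positivity
    linarith

/-- For the cubic itself, the central difference at u is exactly 2b(3u² - N² + b²). Periodizing only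
decreases it for u in [-N, N), and the centered residue u of s satisfies u² ≤ s². -/
theorem periodicCubic_sub_le {N b s t : ℤ} (hN : 0 < N) (hb : 0 < b) (h : 2 * N ∣ s - t) :
    periodicCubic N (t + b) - periodicCubic N (t - b) ≤ 2 * b * (3 * s ^ 2 - N ^ 2 + b ^ 2) := by
  obtain ⟨q, hq⟩ := exists_eq_add_centeredMod N s
  have h1 := neg_le_centeredMod hN s
  have h2 := centeredMod_lt hN s
  set u := centeredMod N s
  have hut : 2 * N ∣ t - u := by
    have : t - u = 2 * N * q - (s - t) := by linarith
    rw [this]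
    exact dvd_sub (dvd_mul_right _ _) h
  rw [periodicCubic_congr (t := t + b) (t' := u + b) (by simpa using hut),
    periodicCubic_congr (t := t - b) (t' := u - b) (by simpa using hut)]
  have h3 := periodicCubic_le hN (t := u + b) (by linarith)
  have h4 := le_periodicCubic hN (t := u - b) (by linarith)
  have h5 : u ^ 2 ≤ s ^ 2 := by
    have key : s ^ 2 - u ^ 2 = 4 * N * (q * (N * q + u)) := by rw [hq]; ring
    have : 0 ≤ q * (N * q + u) := by
      rcases lt_trichotomy q 0 with h | h | h
      · have : N * q ≤ N * (-1) := mul_le_mul_of_nonneg_left (by omega) hN.le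
        exact mul_nonneg_of_nonpos_of_nonpos h.le (by linarith)
      · simp [h]
      · have : N * 1 ≤ N * q := mul_le_mul_of_nonneg_left (by omega) hN.le
        exact mul_nonneg h.le (by linarith)
    have : 0 ≤ 4 * N * (q * (N * q + u)) := by positivity
    linarith
  have h6 : b * u ^ 2 ≤ b * s ^ 2 := mul_le_mul_of_nonneg_left h5 hb.le
  nlinarith

/-- A mean square estimate for integers which are congruent modulo `2 * N` to the terms of an
arithmetic progression with difference `2 * b`, summed over full periods. -/
theorem mul_sub_sq_le_sum_sq {N b a : ℤ} (hN : 0 < N) (hb : b ≠ 0) {M : ℕ} (hM : N ∣ M)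
    (s : ℕ → ℤ) (hs : ∀ k < M, 2 * N ∣ s k - (a + 2 * k * b)) :
    M * (N ^ 2 - b ^ 2) ≤ 3 * ∑ k ∈ Finset.range M, s k ^ 2 := by
  wlog hpos : 0 < b generalizing a b s
  · have := this (b := -b) (a := -a) (neg_ne_zero.2 hb) (fun k => - s k)
      (fun k hk => by
        obtain ⟨q, hq⟩ := hs k hk
        exact ⟨-q, by linear_combination -hq⟩) (by omega)
    simpa using this
  -- The differences telescope, and the endpoints differ by 2Mb, a multiple of the period 2N.
  have htel : ∑ k ∈ Finset.range M, (periodicCubic N (a + 2 * k * b + b)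
      - periodicCubic N (a + 2 * k * b - b)) = 0 := by
    have := Finset.sum_range_sub (fun k : ℕ => periodicCubic N (a + 2 * k * b - b)) M
    rw [periodicCubic_congr (t := a + 2 * M * b - b) (t' := a + 2 * (0 : ℕ) * b - b), sub_self]
      at this
    · rw [← this]
      refine Finset.sum_congr rfl fun k _ => ?_
      congr 2
      push_cast
      ring
    · obtain ⟨c, hc⟩ := hM
      exact ⟨c * b, by rw [hc]; push_cast; ring⟩
  have hle := Finset.sum_le_sum fun k (hk : k ∈ Finset.range M) =>
    periodicCubic_sub_le hN hpos (hs k (Finset.mem_range.1 hk))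
  rw [htel, ← Finset.mul_sum] at hle
  have := nonneg_of_mul_nonneg_right hle (by omega)
  simp only [Finset.sum_add_distrib, Finset.sum_sub_distrib, ← Finset.mul_sum, Finset.sum_const,
    Finset.card_range, nsmul_eq_mul] at this
  linarith

/-- Averaging the one-variable estimate over a box of integer points. -/
theorem pow_mul_sub_sq_le_sum_sq {n M : ℕ} {w : Fin n → ℤ} {N c : ℤ} (hN : 0 < N) (hM : N ∣ M)
    {j : Fin n} (hj : w j ≠ 0) (s : (Fin n → Fin M) → ℤ)
    (hs : ∀ x, 2 * N ∣ s x - (c + 2 * ∑ l, ((x l : ℕ) : ℤ) * w l)) :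
    (M : ℤ) ^ n * (N ^ 2 - w j ^ 2) ≤ 3 * ∑ x, s x ^ 2 := by
  have hfiber : ∀ y : {l // l ≠ j} → Fin M,
      (M : ℤ) * (N ^ 2 - w j ^ 2) ≤ 3 * ∑ k : Fin M, s ((Equiv.funSplitAt j _).symm (k, y)) ^ 2 := by
    intro y
    have h := mul_sub_sq_le_sum_sq hN hj hM
      (a := c + 2 * ∑ l : {l // l ≠ j}, ((y l : ℕ) : ℤ) * w l)
      -- The default 0 is never reached, as the sum runs over k < M.
      (fun k => if hk : k < M then s ((Equiv.funSplitAt j _).symm (⟨k, hk⟩, y)) else 0) ?_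
    · rw [Finset.sum_range] at h
      simpa using h
    · intro k hk
      have := hs ((Equiv.funSplitAt j _).symm (⟨k, hk⟩, y))
      simp only [hk, dif_pos]
      convert this using 2
      rw [Fintype.sum_eq_add_sum_subtype_ne _ j]
      have : ∀ l : {l // l ≠ j},
          (Equiv.funSplitAt j (Fin M)).symm (⟨k, hk⟩, y) l = y l := by
        intro l
        simp [Equiv.funSplitAt, Equiv.piSplitAt, l.2]
      simp only [this]
      simp [Equiv.funSplitAt, Equiv.piSplitAt]
      ring
  have hsum := Finset.sum_le_sum fun y (_ : y ∈ Finset.univ) => hfiber y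
  rw [← Finset.mul_sum _ _ (3 : ℤ), ← Fintype.sum_prod_type_right'
      (f := fun k y => s ((Equiv.funSplitAt j (Fin M)).symm (k, y)) ^ 2),
    Equiv.sum_comp (Equiv.funSplitAt j (Fin M)).symm (fun x => s x ^ 2)] at hsum
  refine le_of_eq_of_le ?_ hsum
  obtain ⟨m, rfl⟩ : ∃ m, n = m + 1 := ⟨n - 1, by have := j.pos; omega⟩
  simp [pow_succ]
  ring

/-! ### Orthogonal families and their norms -/

theorem dotProduct_self_dvd_of_mem_latticeSpan {n : ℕ} {v : Fin n → (Fin n → ℤ)}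
    (hv : ∀ i j, i ≠ j → v i ⬝ᵥ v j = 0) {y : Fin n → ℤ} (hy : y ∈ latticeSpan v) (i : Fin n) :
    v i ⬝ᵥ v i ∣ y ⬝ᵥ v i := by
  induction hy using Submodule.span_induction with
  | mem x hx =>
    obtain ⟨l, rfl⟩ := hx
    by_cases h : l = i
    · rw [h]
    · rw [hv l i h]
      exact dvd_zero _
  | zero => simp
  | add x y _ _ hx hy => rw [add_dotProduct]; exact dvd_add hx hy
  | smul a x _ hx => rw [smul_dotProduct]; exact hx.mul_left _

/-- Bessel's inequality for an orthogonal family of integer vectors. -/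
theorem sum_sq_div_le_dotProduct_self {n : ℕ} {v : Fin n → (Fin n → ℤ)}
    (hpos : ∀ i, 1 ≤ v i ⬝ᵥ v i) (hv : ∀ i j, i ≠ j → v i ⬝ᵥ v j = 0) (e : Fin n → ℤ) :
    ∑ i, ((e ⬝ᵥ v i : ℤ) : ℚ) ^ 2 / (v i ⬝ᵥ v i : ℤ) ≤ (e ⬝ᵥ e : ℤ) := by
  set V : Fin n → Fin n → ℚ := fun i j => v i j
  set E : Fin n → ℚ := fun j => e j
  have hVV : ∀ i l, V i ⬝ᵥ V l = ((v i ⬝ᵥ v l : ℤ) : ℚ) := by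
    intro i l; simp [V, dotProduct]
  have hEV : ∀ i, E ⬝ᵥ V i = ((e ⬝ᵥ v i : ℤ) : ℚ) := by
    intro i; simp [V, E, dotProduct]
  have hEE : E ⬝ᵥ E = ((e ⬝ᵥ e : ℤ) : ℚ) := by simp [E, dotProduct]
  simp only [← hVV, ← hEV, ← hEE]
  have hV0 : ∀ i, V i ⬝ᵥ V i ≠ 0 := by
    intro i
    rw [hVV]
    have := hpos i
    exact_mod_cast (by omega : v i ⬝ᵥ v i ≠ 0)
  set P : Fin n → ℚ := ∑ i, (E ⬝ᵥ V i / (V i ⬝ᵥ V i)) • V i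
  have hEP : E ⬝ᵥ P = ∑ i, (E ⬝ᵥ V i) ^ 2 / (V i ⬝ᵥ V i) := by
    simp only [P, dotProduct_sum, dotProduct_smul, smul_eq_mul]
    exact Finset.sum_congr rfl fun i _ => by ring
  have hVP : ∀ i, V i ⬝ᵥ P = E ⬝ᵥ V i := by
    intro i
    simp only [P, dotProduct_sum, dotProduct_smul, smul_eq_mul]
    rw [Finset.sum_eq_single i]
    · exact div_mul_cancel₀ _ (hV0 i)
    · intro l _ hl
      rw [hVV i l, hv i l (Ne.symm hl)]
      simp
    · simp
  have hPP : P ⬝ᵥ P = ∑ i, (E ⬝ᵥ V i) ^ 2 / (V i ⬝ᵥ V i) := by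
    conv_lhs => enter [1]; simp only [P]
    simp only [sum_dotProduct, smul_dotProduct, smul_eq_mul, hVP]
    exact Finset.sum_congr rfl fun i _ => by ring
  have h0 : 0 ≤ (E - P) ⬝ᵥ (E - P) := by
    simp only [dotProduct]
    exact Finset.sum_nonneg fun i _ => mul_self_nonneg _
  rw [sub_dotProduct, dotProduct_sub, dotProduct_sub, dotProduct_comm P E, hEP, hPP] at h0
  linarith

theorem card_rowSupport_of_pCount_eq {n k : ℕ} {v : Fin n → (Fin n → ℤ)} (hp : pCount v k = n)
    (j : Fin n) : (rowSupport v j).card = k := by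
  have h : (Finset.univ.filter fun j => (rowSupport v j).card = k) = Finset.univ := by
    rw [← Finset.card_eq_iff_eq_univ, Fintype.card_fin]
    exact hp
  simpa using Finset.eq_univ_iff_forall.1 h j

theorem mul_le_sum_dotProduct_self {n k : ℕ} {v : Fin n → (Fin n → ℤ)}
    (hk : ∀ j, (rowSupport v j).card = k) : (n * k : ℤ) ≤ ∑ i, v i ⬝ᵥ v i := by
  simp only [dotProduct]
  rw [Finset.sum_comm]
  have : ∀ j ∈ Finset.univ, (k : ℤ) ≤ ∑ i, v i j * v i j := by
    intro j _
    rw [← hk j, rowSupport, Finset.card_filter]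
    push_cast
    refine Finset.sum_le_sum fun i _ => ?_
    split_ifs with h
    · have := mul_self_pos.2 h
      omega
    · exact mul_self_nonneg _
  simpa using Finset.sum_le_sum this

/-- If each row meets at least two members of an orthogonal family, then each member has a nonzero
coordinate, and it is not concentrated there. -/
theorem exists_sq_lt_dotProduct_self {n : ℕ} {v : Fin n → (Fin n → ℤ)}
    (hpos : ∀ i, 1 ≤ v i ⬝ᵥ v i) (hv : ∀ i j, i ≠ j → v i ⬝ᵥ v j = 0)
    (hrow : ∀ j, 1 < (rowSupport v j).card) (i : Fin n) :
    ∃ j, v i j ≠ 0 ∧ v i j ^ 2 < v i ⬝ᵥ v i := by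
  obtain ⟨j, hj⟩ : ∃ j, v i j ≠ 0 := by
    by_contra! h
    have := hpos i
    simp [dotProduct, h] at this
  refine ⟨j, hj, ?_⟩
  obtain ⟨l, hl, hli⟩ := Finset.exists_mem_ne (hrow j) i
  have hlj : v l j ≠ 0 := by simpa [rowSupport] using hl
  -- If `v i` lived on coordinate j alone, it could not be orthogonal to `v l`, which is also
  -- nonzero there.
  obtain ⟨m, hmj, hm⟩ : ∃ m, m ≠ j ∧ v i m ≠ 0 := by
    by_contra! h
    have h0 := hv i l (Ne.symm hli)
    rw [dotProduct, Finset.sum_eq_single j (fun m _ hm => by rw [h m hm, zero_mul]) (by simp)] at h0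
    exact mul_ne_zero hj hlj h0
  rw [dotProduct, ← Finset.add_sum_erase _ _ (Finset.mem_univ j), sq]
  have : 0 < ∑ x ∈ Finset.univ.erase j, v i x * v i x :=
    Finset.sum_pos' (fun _ _ => mul_self_nonneg _)
      ⟨m, Finset.mem_erase.2 ⟨hmj, Finset.mem_univ _⟩, mul_self_pos.2 hm⟩
  omega

/-! ### Sign vectors and the contradiction -/

/-- A cubiquitous lattice contains, for each `x`, half the difference of `2 * x + 1` and a sign
vector. -/
theorem IsCubiquitous.exists_sign_vector {n : ℕ} {L : Submodule ℤ (Fin n → ℤ)}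
    (hL : IsCubiquitous L) (x : Fin n → ℤ) :
    ∃ e : Fin n → ℤ, e ⬝ᵥ e = n ∧ ∃ y ∈ L, e = 1 + (2 : ℤ) • x - (2 : ℤ) • y := by
  obtain ⟨y, hy, d, hd, rfl⟩ := hL x
  refine ⟨1 - (2 : ℤ) • d, ?_, x + d, hy, ?_⟩
  · have : ∀ i, (1 - (2 : ℤ) • d) i * (1 - (2 : ℤ) • d) i = 1 := by
      intro i
      rcases hd i with h | h <;> simp [h]
    simp only [dotProduct, this]
    simp
  · rw [smul_add]
    abel

theorem mainTheorem6 (n : ℕ) (hn : 1 ≤ n) (v : Fin n → (Fin n → ℤ))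
    (hv : IsOrthogonalSubset v) (hp : pCount v 4 = n) :
    ¬ IsCubiquitous (latticeSpan v) := by
  intro hcub
  obtain ⟨⟨hpos, -, -⟩, horth⟩ := hv
  have hrow := card_rowSupport_of_pCount_eq hp
  choose j hj hjlt using exists_sq_lt_dotProduct_self hpos horth fun j => by rw [hrow j]; norm_num
  -- A common multiple of the norms, so that one box serves all i.
  set M : ℕ := ∏ i, (v i ⬝ᵥ v i).toNat with hMdef
  have hcast : ∀ i, ((v i ⬝ᵥ v i).toNat : ℤ) = v i ⬝ᵥ v i := fun i =>
    Int.toNat_of_nonneg (by have := hpos i; omega)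
  have hMdvd : ∀ i, v i ⬝ᵥ v i ∣ (M : ℤ) := by
    intro i
    rw [← hcast i]
    exact Int.natCast_dvd_natCast.2 (Finset.dvd_prod_of_mem _ (Finset.mem_univ i))
  have hMpos : 0 < M := Finset.prod_pos fun i _ => by have := hpos i; omega
  choose e he y hy hey using fun x : Fin n → Fin M =>
    hcub.exists_sign_vector fun l => ((x l : ℕ) : ℤ)
  have hmean : ∀ i, (M : ℤ) ^ n * ((v i ⬝ᵥ v i) ^ 2 - v i (j i) ^ 2)
      ≤ 3 * ∑ x, (e x ⬝ᵥ v i) ^ 2 := by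
    intro i
    refine pow_mul_sub_sq_le_sum_sq (w := v i) (c := 1 ⬝ᵥ v i) (by have := hpos i; omega)
      (hMdvd i) (hj i) _ fun x => ?_
    rw [hey x, sub_dotProduct, add_dotProduct, smul_dotProduct, smul_dotProduct]
    obtain ⟨q, hq⟩ := dotProduct_self_dvd_of_mem_latticeSpan horth (hy x) i
    refine ⟨-q, ?_⟩
    rw [hq, smul_eq_mul, smul_eq_mul]
    simp only [dotProduct]
    ring
  have hM0 : (0 : ℚ) < (M : ℚ) ^ n := by positivity
  have hstrict : ∀ i, (M : ℚ) ^ n * ((v i ⬝ᵥ v i : ℤ) - 1)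
      < 3 * ∑ x, ((e x ⬝ᵥ v i : ℤ) : ℚ) ^ 2 / (v i ⬝ᵥ v i : ℤ) := by
    intro i
    have h1 : (M : ℚ) ^ n * (((v i ⬝ᵥ v i : ℤ) : ℚ) ^ 2 - (v i (j i) : ℚ) ^ 2)
        ≤ 3 * ∑ x, ((e x ⬝ᵥ v i : ℤ) : ℚ) ^ 2 := by exact_mod_cast hmean i
    have h2 : (v i (j i) : ℚ) ^ 2 < (v i ⬝ᵥ v i : ℤ) := by exact_mod_cast hjlt i
    have h3 : (0 : ℚ) < (v i ⬝ᵥ v i : ℤ) := by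
      have := hpos i
      exact_mod_cast (by omega : 0 < v i ⬝ᵥ v i)
    rw [← Finset.sum_div, ← mul_div_assoc, lt_div_iff₀ h3]
    refine lt_of_lt_of_le ?_ h1
    rw [mul_assoc]
    exact mul_lt_mul_of_pos_left (by linarith) hM0
  have hlt := Finset.sum_lt_sum_of_nonempty (s := Finset.univ) ⟨⟨0, hn⟩, Finset.mem_univ _⟩
    fun i _ => hstrict i
  rw [← Finset.mul_sum, ← Finset.mul_sum, Finset.sum_comm] at hlt
  have hbessel := Finset.sum_le_sum fun x (_ : x ∈ Finset.univ) =>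
    sum_sq_div_le_dotProduct_self hpos horth (e x)
  simp only [he, Finset.sum_const, Finset.card_univ, Fintype.card_fun, Fintype.card_fin,
    nsmul_eq_mul, Nat.cast_pow, Int.cast_natCast] at hbessel
  have hnorm : ((n : ℚ) * 4) ≤ ∑ i, ((v i ⬝ᵥ v i : ℤ) : ℚ) := by
    exact_mod_cast mul_le_sum_dotProduct_self hrow
  have hfinal : (M : ℚ) ^ n * (n * 3) ≤ (M : ℚ) ^ n * ∑ i, (((v i ⬝ᵥ v i : ℤ) : ℚ) - 1) := by
    refine mul_le_mul_of_nonneg_left ?_ hM0.le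
    simp only [Finset.sum_sub_distrib, Finset.sum_const, Finset.card_univ, Fintype.card_fin,
      nsmul_eq_mul, mul_one]
    linarith
  linarith
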